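/- For $n\ge 1$ let $S_n$ be the group of permutations of an interval of $n$ consecutive integers, say $\{0,1,\dots,n-1\}$, with the metric $d(f,g)=\max_i|f(i)-g(i)|$. For $\mathcal C\subseteq S_n$ with at least two elements put $d(\mathcal C)=\min\{d(f,g): f,g\in\mathcal C,\ f\neq g\}$ and $\mathcal L_{\max}(\mathcal C)=\max_{l\in S_n} d(l\,\mathcal C\,l^{-1})$. For a prime $q$ let $\mathrm{AGL}(q)\le S_q$ be the group of permutations of $\{0,1,\dots,q-1\}$ generated by $x\mapsto x+1$ and $x\mapsto ax$ (arithmetic modulo $q$), where $a$ is a primitive element of $\mathrm{GF}(q)$. Theorem. There are an absolute constant $K>0$ and an integer $N$ such that for every prime $q\ge N$ (and every choice of the primitive element $a$), $$q-K\sqrt{q\ln q}\;\le\;\mathcal L_{\max}(\mathrm{AGL}(q))\;\le\; q-\left\lceil\frac{\sqrt{4q-3}-1}{2}\right\rceil .$$ -/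

import Mathlib

namespace Relabeling

/-- The `ℓ_∞`-distance `max_i |f(i) - g(i)|` between two permutations of `{0, …, n-1}`. -/
def dist {n : ℕ} (f g : Equiv.Perm (Fin n)) : ℕ :=
  Finset.univ.sup fun i : Fin n => ((f i : ℤ) - (g i : ℤ)).natAbs

/-- The minimal distance of a code, i.e. the least `dist f g` over distinct codewords `f`, `g`
(meaningful for codes with at least two codewords; the value is `0` otherwise). -/
noncomputable def minDist {n : ℕ} (C : Set (Equiv.Perm (Fin n))) : ℕ :=
  sInf {d : ℕ | ∃ f ∈ C, ∃ g ∈ C, f ≠ g ∧ d = dist f g}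

/-- The relabeling `l C l⁻¹` of a code `C` by a labeling `l`. -/
def relabel {n : ℕ} (l : Equiv.Perm (Fin n)) (C : Set (Equiv.Perm (Fin n))) :
    Set (Equiv.Perm (Fin n)) :=
  (fun c => l * c * l⁻¹) '' C

/-- The largest minimal distance among all relabelings of the code `C`. -/
noncomputable def Lmax {n : ℕ} (C : Set (Equiv.Perm (Fin n))) : ℕ :=
  Finset.univ.sup fun l : Equiv.Perm (Fin n) => minDist (relabel l C)

/-- The identification of `ℤ/q` with `{0, …, q-1}` by least nonnegative residues. -/
def residue (q : ℕ) [NeZero q] : ZMod q ≃ Fin q where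
  toFun x := ⟨x.val, ZMod.val_lt x⟩
  invFun i := ((i : ℕ) : ZMod q)
  left_inv x := ZMod.natCast_zmod_val x
  right_inv i := Fin.ext (ZMod.val_cast_of_lt i.isLt)

/-- The subgroup of the permutations of `{0, …, q-1}` generated by `x ↦ x + 1` and `x ↦ a x`,
with arithmetic modulo `q`. For `q` prime and `a` a primitive element this is `AGL(q)`. -/
def AGL (q : ℕ) [NeZero q] (a : (ZMod q)ˣ) : Subgroup (Equiv.Perm (Fin q)) :=
  Subgroup.closure
    {(residue q).permCongr (Equiv.addRight (1 : ZMod q)),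
      (residue q).permCongr (Units.mulLeft a)}

end Relabeling

namespace Relabeling

open Finset

/-! Upper bound: if a relabeling has minimal distance D, each translation by b ≠ 0 moves some x to x
+ b with labels at least D apart. The label pair determines b, and with r = q - D at most r(r+1)
ordered pairs are that far apart, so q - 1 ≤ r(r+1).

Lower bound: the metric is right-invariant, so it suffices to find disjoint sets A, B of size O(√(q
ln q)) such that every nonidentity affine map sends a point of A into B; label A lowest and B
highest. Take A to be essentially a segment of length s. A nonidentity affine map either hits a
point adjacent to the segment, or reverses the segment, or moves about s/4 of its points outside
(`affine_segment`). The first two cases cost a few extra points; in the third, B must hit at most q²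
sets of size k ≈ s/4, which a greedy choice achieves with about 2q ln q / k points
(`exists_hitting`). Balancing s against this number gives √(q ln q). -/

/-! ### Greedy hitting sets -/

/-- A greedy hitting set: after `j` steps the proportion of sets missed is at most
`(1 - k / |α|) ^ j`. -/
theorem exists_greedy_hitting {α : Type*} [Fintype α] [DecidableEq α] (F : Finset (Finset α))
    (k : ℕ) (hF : ∀ S ∈ F, k ≤ #S) (hk : k ≤ Fintype.card α) (hα : 0 < Fintype.card α) (j : ℕ) :
    ∃ B : Finset α, #B ≤ j ∧
      #{S ∈ F | Disjoint S B} * Fintype.card α ^ j ≤ #F * (Fintype.card α - k) ^ j := by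
  induction j with
  | zero => exact ⟨∅, by simp⟩
  | succ j ih =>
    obtain ⟨B, hB, hcard⟩ := ih
    set G := {S ∈ F | Disjoint S B} with hG
    have hsum : ∑ x : α, #{S ∈ G | x ∈ S} = ∑ S ∈ G, #S := by
      simp only [card_eq_sum_ones, sum_filter]
      rw [sum_comm]
      simp
    have hge : k * #G ≤ ∑ x : α, #{S ∈ G | x ∈ S} := by
      rw [hsum, mul_comm, ← smul_eq_mul]
      exact card_nsmul_le_sum _ _ _ fun S hS => hF S (mem_filter.1 hS).1
    have hne : (univ : Finset α).Nonempty := univ_nonempty_iff.2 (Fintype.card_pos_iff.1 hα)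
    -- Averaging: some point lies in at least a fraction k / |α| of the sets still missed.
    obtain ⟨x, -, hx⟩ : ∃ x ∈ (univ : Finset α),
        k * #G ≤ Fintype.card α * #{S ∈ G | x ∈ S} := by
      by_contra! h
      have := sum_lt_sum_of_nonempty hne h
      rw [← mul_sum, sum_const, card_univ, smul_eq_mul] at this
      exact absurd (lt_of_mul_lt_mul_left this (Nat.zero_le _)) (not_lt.2 hge)
    refine ⟨insert x B, (card_insert_le _ _).trans (by omega), ?_⟩
    have hsplit : #{S ∈ G | x ∈ S} + #{S ∈ F | Disjoint S (insert x B)} = #G := by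
      rw [← card_filter_add_card_filter_not (s := G) (fun S => x ∈ S)]
      congr 2
      ext S
      simp only [hG, mem_filter, disjoint_insert_right]
      tauto
    obtain ⟨c, hc⟩ := Nat.exists_eq_add_of_le hk
    have hstep : #{S ∈ F | Disjoint S (insert x B)} * Fintype.card α
        ≤ #G * (Fintype.card α - k) := by
      have h1 : Fintype.card α - k = c := by omega
      rw [h1]
      generalize #{S ∈ F | Disjoint S (insert x B)} = u at *
      generalize #{S ∈ G | x ∈ S} = v at *
      rw [hc] at hx ⊢
      rw [← hsplit] at hx ⊢
      nlinarith
    calc _ = #{S ∈ F | Disjoint S (insert x B)} * Fintype.card α * Fintype.card α ^ j := by ring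
      _ ≤ #G * (Fintype.card α - k) * Fintype.card α ^ j := by gcongr
      _ = #G * Fintype.card α ^ j * (Fintype.card α - k) := by ring
      _ ≤ #F * (Fintype.card α - k) ^ j * (Fintype.card α - k) := by gcongr
      _ = _ := by ring

/-- Since 1 - x ≤ exp(-x), the greedy choice misses at most |F| exp(-kj/|α|) < 1 sets, hence none.
-/
theorem exists_hitting {α : Type*} [Fintype α] [DecidableEq α] (F : Finset (Finset α))
    (k j : ℕ) (hF : ∀ S ∈ F, k ≤ #S) (hk : k ≤ Fintype.card α) (hα : 0 < Fintype.card α)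
    (hj : Real.log #F * Fintype.card α < k * j) :
    ∃ B : Finset α, #B ≤ j ∧ ∀ S ∈ F, ∃ x ∈ S, x ∈ B := by
  obtain ⟨B, hB, h⟩ := exists_greedy_hitting F k hF hk hα j
  refine ⟨B, hB, fun S hS => ?_⟩
  by_contra! hSB
  have hpos : 0 < #{S ∈ F | Disjoint S B} :=
    card_pos.2 ⟨S, mem_filter.2 ⟨hS, disjoint_left.2 hSB⟩⟩
  have hFpos : (0 : ℝ) < #F := by exact_mod_cast card_pos.2 ⟨S, hS⟩
  set n := Fintype.card α with hn
  have hn0 : (0 : ℝ) < n := by exact_mod_cast hα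
  have h1 : (n : ℝ) ^ j ≤ #F * ((n : ℝ) - k) ^ j := by
    rw [← Nat.cast_sub hk]
    exact_mod_cast (Nat.le_mul_of_pos_left _ hpos).trans h
  have hnk : (0 : ℝ) ≤ (n : ℝ) - k := by rw [← Nat.cast_sub hk]; positivity
  have h2 : (n : ℝ) - k ≤ n * Real.exp (-(k / n)) := by
    have := Real.add_one_le_exp (-((k : ℝ) / n))
    calc (n : ℝ) - k = n * (-((k : ℝ) / n) + 1) := by field_simp; ring
      _ ≤ _ := by gcongr
  have h3 : (n : ℝ) ^ j ≤ n ^ j * (#F * Real.exp (-(k / n) * j)) := by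
    calc (n : ℝ) ^ j ≤ #F * ((n : ℝ) - k) ^ j := h1
      _ ≤ #F * (n * Real.exp (-(k / n))) ^ j := by gcongr
      _ = _ := by rw [mul_pow, mul_comm (-((k : ℝ) / n)), Real.exp_nat_mul]; ring
  have h4 : (1 : ℝ) ≤ #F * Real.exp (-(k / n) * j) := by
    have : (0 : ℝ) < (n : ℝ) ^ j := by positivity
    exact le_of_mul_le_mul_left (by rwa [mul_one]) this
  have h5 : (#F : ℝ) * Real.exp (-(k / n) * j) < 1 := by
    rw [← Real.exp_log hFpos, ← Real.exp_add, Real.exp_lt_one_iff]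
    have : Real.log #F < k * j / n := by rwa [lt_div_iff₀ hn0]
    calc Real.log #F + -(k / n) * j = Real.log #F - k * j / n := by ring
      _ < 0 := by linarith
  linarith

/-! ### Affine maps acting on a segment -/

/-- The image of `{0, …, s-1}` in `ZMod q`. -/
def segment (q s : ℕ) : Finset (ZMod q) := (range s).image Nat.cast

theorem mem_segment {q s : ℕ} {z : ZMod q} : z ∈ segment q s ↔ ∃ n < s, (n : ZMod q) = z := by
  simp [segment]

theorem natCast_inj_of_lt {q m n : ℕ} (hm : m < q) (hn : n < q) (h : (m : ZMod q) = n) :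
    m = n := by
  rw [ZMod.natCast_eq_natCast_iff', Nat.mod_eq_of_lt hm, Nat.mod_eq_of_lt hn] at h
  exact h

theorem natCast_notMem_segment {q s v : ℕ} (hs : s ≤ v) (hv : v < q) :
    (v : ZMod q) ∉ segment q s := by
  rw [mem_segment]
  rintro ⟨n, hn, h⟩
  have := natCast_inj_of_lt (by omega) hv h
  omega

theorem card_segment {q s : ℕ} (hs : s ≤ q) : #(segment q s) = s := by
  rw [segment, card_image_of_injOn, card_range]
  intro m hm n hn h
  simp only [coe_range, Set.mem_Iio] at hm hn
  exact natCast_inj_of_lt (by omega) (by omega) h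

/-- Steps of size |d| ≥ 2, for d the least absolute residue of `a`, leave the segment in about s/2
steps without wrapping around to it. -/
theorem exists_nat_mul_eq_far {q s : ℕ} [NeZero q] (hs : 1 ≤ s) (hq : 3 * s ≤ q) {a : ZMod q}
    (h0 : a ≠ 0) (h1 : a ≠ 1) (hn1 : a ≠ -1) :
    ∃ m : ℕ, 2 * m ≤ s + 1 ∧ ∃ e : ℤ, a * m = e ∧ s ≤ e.natAbs ∧ e.natAbs + s ≤ q := by
  have hle := ZMod.natAbs_valMinAbs_le a
  have hd : ((a.valMinAbs : ℤ) : ZMod q) = a := ZMod.coe_valMinAbs a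
  set d := a.valMinAbs
  have hd2 : 2 ≤ d.natAbs := by
    by_contra! h
    have : d = 0 ∨ d = 1 ∨ d = -1 := by omega
    rcases this with h | h | h <;> rw [h] at hd <;> simp at hd
    · exact h0 hd.symm
    · exact h1 hd.symm
    · exact hn1 hd.symm
  by_cases hsd : s ≤ d.natAbs
  · exact ⟨1, by omega, d, by simp [hd], hsd, by omega⟩
  · set D := d.natAbs with hD
    -- This is ⌈s / D⌉, so D m lies between s and s + D - 1 < 2s, and 3s ≤ q excludes wrapping.
    set m := (s + D - 1) / D with hm
    have e1 : D * m ≤ s + D - 1 := Nat.mul_div_le _ _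
    have e2 : s + D - 1 < D * m + D := Nat.lt_mul_div_succ _ (by omega)
    refine ⟨m, ?_, d * m, by push_cast; rw [hd], ?_, ?_⟩
    · rcases m with _ | m
      · omega
      · have : 2 * m ≤ D * m := Nat.mul_le_mul_right _ hd2
        rw [mul_add] at e1
        omega
    · rw [Int.natAbs_mul, Int.natAbs_natCast, ← hD]; omega
    · rw [Int.natAbs_mul, Int.natAbs_natCast, ← hD]; omega

theorem segment_sub_ne {q s : ℕ} {y z : ZMod q} (hy : y ∈ segment q s) (hz : z ∈ segment q s)
    {e : ℤ} (he : s ≤ e.natAbs) (he' : e.natAbs + s ≤ q) : z ≠ y + e := by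
  obtain ⟨n, hn, rfl⟩ := mem_segment.1 hy
  obtain ⟨m, hm, rfl⟩ := mem_segment.1 hz
  intro h
  have h' : ((m : ℤ) : ZMod q) = ((n + e : ℤ) : ZMod q) := by push_cast; exact h
  rw [ZMod.intCast_eq_intCast_iff_dvd_sub] at h'
  have := Int.eq_zero_of_abs_lt_dvd h' (by rw [abs_lt]; omega)
  omega

/-- An affine map with multiplier other than `±1` moves a quarter of a segment outside. -/
theorem le_card_affine_notMem_segment {q s : ℕ} [NeZero q] (hs : 1 ≤ s) (hq : 3 * s ≤ q)
    {a : ZMod q} (h0 : a ≠ 0) (h1 : a ≠ 1) (hn1 : a ≠ -1) (b : ZMod q) :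
    s ≤ 4 * #{n ∈ range s | a * (n : ℕ) + b ∉ segment q s} + 1 := by
  obtain ⟨m, hm, e, hme, he, he'⟩ := exists_nat_mul_eq_far hs hq h0 h1 hn1
  -- Of n and n + m at least one is mapped outside, as the images differ by e; this yields at least
  -- (s - m)/2 such points.
  have hinj : #{n ∈ range (s - m) | a * (n : ℕ) + b ∈ segment q s} ≤
      #{n ∈ range s | a * (n : ℕ) + b ∉ segment q s} := by
    refine card_le_card_of_injOn (· + m) ?_ (fun x _ y _ h => by simpa using h)
    intro n hn
    simp only [coe_filter, mem_range, Set.mem_ofPred_eq] at hn ⊢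
    refine ⟨by omega, fun h => segment_sub_ne hn.2 h he he' ?_⟩
    rw [← hme]; push_cast; ring
  have hsub : #{n ∈ range (s - m) | a * (n : ℕ) + b ∉ segment q s} ≤
      #{n ∈ range s | a * (n : ℕ) + b ∉ segment q s} :=
    card_le_card (filter_subset_filter _ (range_subset_range.2 (Nat.sub_le _ _)))
  have hsum := card_filter_add_card_filter_not (s := range (s - m))
    (fun n : ℕ => a * n + b ∈ segment q s)
  rw [card_range] at hsum
  omega

/-- Translations and reflections keep the segment an interval: its image contains a neighbour `s` or
`-1`, or is disjoint from it, or equals it. Equality without being the identity leaves only x ↦ s -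
1 - x. -/
theorem affine_segment {q s : ℕ} [NeZero q] (hs : 1 ≤ s) (hq : 3 * s ≤ q) {a b : ZMod q}
    (h0 : a ≠ 0) (hid : ¬(a = 1 ∧ b = 0)) :
    (∃ n < s, a * (n : ℕ) + b = s ∨ a * (n : ℕ) + b = -1) ∨ (a = -1 ∧ b + 1 = s) ∨
      s ≤ 4 * #{n ∈ range s | a * (n : ℕ) + b ∉ segment q s} + 1 := by
  have hv : ((b.val : ℕ) : ZMod q) = b := ZMod.natCast_zmod_val b
  have hvq : b.val < q := ZMod.val_lt b
  have hcq : ∀ n : ℕ, n = q - 1 → (n : ZMod q) = -1 := by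
    rintro _ rfl
    rw [Nat.cast_sub (by omega)]; simp
  have hall : (∀ n < s, a * (n : ℕ) + b ∉ segment q s) →
      s ≤ 4 * #{n ∈ range s | a * (n : ℕ) + b ∉ segment q s} + 1 := by
    intro h
    rw [filter_true_of_mem (fun n hn => h n (mem_range.1 hn)), card_range]; omega
  by_cases h1 : a = 1
  · subst h1
    have hb : b.val ≠ 0 := fun h => hid ⟨rfl, (ZMod.val_eq_zero b).1 h⟩
    have hform : ∀ n : ℕ, (1 : ZMod q) * n + b = ((n + b.val : ℕ) : ZMod q) := by
      intro n; push_cast; rw [hv]; ring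
    simp only [hform] at hall ⊢
    rcases le_or_gt b.val s with h | h
    · exact Or.inl ⟨s - b.val, by omega, Or.inl (by congr 1; omega)⟩
    rcases le_or_gt (q - s) b.val with h' | h'
    · exact Or.inl ⟨q - 1 - b.val, by omega, Or.inr (hcq _ (by omega))⟩
    · exact Or.inr (Or.inr (hall fun n hn => natCast_notMem_segment (by omega) (by omega)))
  by_cases hn1 : a = -1
  · subst hn1
    have hform : ∀ n : ℕ, n ≤ b.val → (-1 : ZMod q) * n + b = ((b.val - n : ℕ) : ZMod q) := by
      intro n hn; rw [Nat.cast_sub hn, hv]; ring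
    rcases lt_or_ge (b.val + 1) s with h | h
    · refine Or.inl ⟨b.val + 1, h, Or.inr ?_⟩
      push_cast; rw [hv]; ring
    rcases h.eq_or_lt with h | h
    · refine Or.inr (Or.inl ⟨rfl, ?_⟩)
      rw [h]; push_cast; rw [hv]
    rcases lt_or_ge b.val (2 * s) with h' | h'
    · refine Or.inl ⟨b.val - s, by omega, Or.inl ?_⟩
      rw [hform _ (by omega)]; congr 1; omega
    · refine Or.inr (Or.inr (hall fun n hn => ?_))
      rw [hform _ (by omega)]
      exact natCast_notMem_segment (by omega) (by omega)
  · exact Or.inr (Or.inr (le_card_affine_notMem_segment hs hq h0 h1 hn1 b))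

/-- Two small disjoint sets such that every nonidentity affine map sends some point of the first
into the second. -/
theorem exists_disjoint_sets_affine_meet {q : ℕ} [Fact q.Prime] {s k j : ℕ} (hs : 5 ≤ s)
    (hq : 3 * s ≤ q) (hk : 4 * k + 5 ≤ s) (hj : 2 * Real.log q * q < k * j) :
    ∃ A B : Finset (ZMod q), Disjoint A B ∧ #A ≤ s + 1 ∧ #B ≤ j + 3 ∧
      ∀ a b : ZMod q, a ≠ 0 → ¬(a = 1 ∧ b = 0) → ∃ x ∈ A, a * x + b ∈ B := by
  -- The extra point s + 1 handles the reflection x ↦ s - 1 - x, which sends it to -2.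
  set A : Finset (ZMod q) := insert ((s + 1 : ℕ) : ZMod q) (segment q s) with hA
  let S : ZMod q × ZMod q → Finset (ZMod q) :=
    fun g => (segment q s).image (fun x => g.1 * x + g.2) \ A
  set F := {T ∈ univ.image S | k ≤ #T} with hFdef
  have hcq : Fintype.card (ZMod q) = q := ZMod.card q
  have hFq : #F ≤ q * q := by
    refine (card_filter_le _ _).trans (card_image_le.trans ?_)
    rw [card_univ, Fintype.card_prod, hcq]
  have hq1 : (1 : ℝ) ≤ q := by exact_mod_cast (by omega : 1 ≤ q)
  have hlog : Real.log #F ≤ 2 * Real.log q := by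
    rcases Nat.eq_zero_or_pos #F with h | h
    · rw [h]; simpa using Real.log_nonneg hq1
    · calc Real.log #F ≤ Real.log ((q : ℝ) * q) :=
            Real.log_le_log (by exact_mod_cast h) (by exact_mod_cast hFq)
        _ = 2 * Real.log q := by rw [Real.log_mul (by positivity) (by positivity)]; ring
  obtain ⟨B₀, hB₀, hhit⟩ := exists_hitting F k j (fun T hT => (mem_filter.1 hT).2)
    (by omega) (by omega) (by
      rw [hcq]
      exact (mul_le_mul_of_nonneg_right hlog (by positivity)).trans_lt hj)
  have hneg : ∀ c n : ℕ, n + c = q → (n : ZMod q) = -(c : ZMod q) := by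
    intro c n h
    rw [eq_neg_iff_add_eq_zero, ← Nat.cast_add, h, ZMod.natCast_self]
  have hnotA : ∀ v : ℕ, s ≤ v → v < q → v ≠ s + 1 → (v : ZMod q) ∉ A := by
    intro v h1 h2 h3 h
    rcases mem_insert.1 h with h | h
    · exact h3 (natCast_inj_of_lt h2 (by omega) h)
    · exact natCast_notMem_segment h1 h2 h
  have hm1 : (-1 : ZMod q) = ((q - 1 : ℕ) : ZMod q) := by
    rw [hneg 1 (q - 1) (by omega)]; simp
  have hm2 : (-2 : ZMod q) = ((q - 2 : ℕ) : ZMod q) := by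
    rw [hneg 2 (q - 2) (by omega)]; simp
  -- Removing `A` from `B₀` is harmless: the sets `S g` already avoid `A`.
  refine ⟨A, insert (s : ZMod q) (insert (-1) (insert (-2) (B₀ \ A))), ?_, ?_, ?_, ?_⟩
  · rw [disjoint_insert_right, disjoint_insert_right, disjoint_insert_right]
    refine ⟨hnotA s le_rfl (by omega) (by omega), ?_, ?_, disjoint_sdiff⟩
    · rw [hm1]; exact hnotA _ (by omega) (by omega) (by omega)
    · rw [hm2]; exact hnotA _ (by omega) (by omega) (by omega)
  · refine (card_insert_le _ _).trans ?_
    rw [card_segment (by omega)]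
  · have h1 := card_insert_le (s : ZMod q) (insert (-1) (insert (-2) (B₀ \ A)))
    have h2 := card_insert_le (-1 : ZMod q) (insert (-2) (B₀ \ A))
    have h3 := card_insert_le (-2 : ZMod q) (B₀ \ A)
    have h4 : #(B₀ \ A) ≤ #B₀ := card_le_card sdiff_subset
    omega
  · intro a b h0 hid
    rcases affine_segment (by omega) hq h0 hid with ⟨n, hn, h⟩ | ⟨rfl, h⟩ | h
    · refine ⟨n, mem_insert_of_mem (mem_segment.2 ⟨n, hn, rfl⟩), ?_⟩
      simp only [mem_insert]
      tauto
    · refine ⟨_, mem_insert_self _ _, ?_⟩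
      have : -1 * ((s + 1 : ℕ) : ZMod q) + b = -2 := by
        push_cast; rw [← h]; ring
      rw [this]
      simp
    · have hinj : Function.Injective fun x : ZMod q => a * x + b := fun x y h =>
        mul_left_cancel₀ h0 (add_right_cancel h)
      set T := {n ∈ range s | a * (n : ℕ) + b ∉ segment q s} with hT
      have hTc : #(T.image fun n : ℕ => a * (n : ZMod q) + b) = #T := by
        refine card_image_of_injOn fun m hm n hn h => ?_
        simp only [hT, coe_filter, mem_range, Set.mem_ofPred_eq] at hm hn
        exact natCast_inj_of_lt (by omega) (by omega) (hinj h)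
      have hsub : (T.image fun n : ℕ => a * (n : ZMod q) + b).erase ((s + 1 : ℕ) : ZMod q) ⊆
          S (a, b) := by
        intro z hz
        obtain ⟨hz1, hz2⟩ := mem_erase.1 hz
        obtain ⟨n, hn, rfl⟩ := mem_image.1 hz2
        obtain ⟨hn1, hn2⟩ := mem_filter.1 hn
        refine mem_sdiff.2 ⟨mem_image.2 ⟨n, mem_segment.2 ⟨n, mem_range.1 hn1, rfl⟩, rfl⟩, ?_⟩
        rw [hA, mem_insert]
        tauto
      -- s ≥ 4k + 5 gives k + 1 points outside the segment; at most one of them is s + 1.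
      have hcard : k ≤ #(S (a, b)) := by
        have h1 := card_le_card hsub
        have h2 := pred_card_le_card_erase (s := T.image fun n : ℕ => a * (n : ZMod q) + b)
          (a := ((s + 1 : ℕ) : ZMod q))
        omega
      obtain ⟨y, hy, hyB⟩ := hhit (S (a, b)) (mem_filter.2 ⟨mem_image_of_mem _ (mem_univ _), hcard⟩)
      obtain ⟨hy1, hy2⟩ := mem_sdiff.1 hy
      obtain ⟨x, hx, rfl⟩ := mem_image.1 hy1
      refine ⟨x, mem_insert_of_mem hx, ?_⟩
      simp only [mem_insert, mem_sdiff]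
      exact Or.inr (Or.inr (Or.inr ⟨hyB, hy2⟩))

/-! ### Labelings and the elements of AGL(q) -/

/-- A bijection onto `Fin n` that puts `A` at the bottom and `B` at the top. -/
theorem exists_equiv_fin_bottom_top {α : Type*} [Fintype α] [DecidableEq α] {n : ℕ}
    (hn : Fintype.card α = n) {A B : Finset α} (hAB : Disjoint A B) :
    ∃ l : α ≃ Fin n, (∀ x ∈ A, (l x : ℕ) < #A) ∧ ∀ x ∈ B, n ≤ (l x : ℕ) + #B := by
  have hidx : ∀ C : Finset α, ∃ φ : α → ℕ, Set.InjOn φ C ∧ ∀ x ∈ C, φ x < #C := by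
    intro C
    refine ⟨fun x => if h : x ∈ C then C.equivFin ⟨x, h⟩ else 0, fun x hx y hy h => ?_,
      fun x hx => by simp [hx]⟩
    have hx' : x ∈ C := hx
    have hy' : y ∈ C := hy
    simpa [hx', hy', Fin.val_inj] using h
  obtain ⟨φ, hφ, hφA⟩ := hidx A
  obtain ⟨ψ, hψ, hψB⟩ := hidx B
  have hcard : #A + #B ≤ n := by
    rw [← card_union_of_disjoint hAB, ← hn]; exact card_le_univ _
  -- `A` is numbered upwards from 0 and `B` downwards from n - 1; values elsewhere are discarded by
  -- the extension.
  let f : α → ℕ := fun x => if x ∈ A then φ x else n - 1 - ψ x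
  have hBA : ∀ x ∈ B, x ∉ A := fun x hx hx' => disjoint_left.1 hAB hx' hx
  have hfA : ∀ x ∈ A, f x = φ x := fun x hx => if_pos hx
  have hfB : ∀ x ∈ B, f x = n - 1 - ψ x := fun x hx => if_neg (hBA x hx)
  obtain ⟨g, hg⟩ := exists_equiv_extend_of_card_eq (t := range n) (by rw [hn, card_range])
    (s := A ∪ B) (f := f) (by
      intro z hz
      obtain ⟨x, hx, rfl⟩ := mem_image.1 hz
      rw [mem_range]
      rcases mem_union.1 hx with hx | hx
      · rw [hfA x hx]; have := hφA x hx; omega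
      · rw [hfB x hx]; have := hψB x hx; omega) (by
      intro x hx y hy h
      rcases mem_union.1 hx with hx | hx <;> rcases mem_union.1 hy with hy | hy
      · rw [hfA x hx, hfA y hy] at h; exact hφ hx hy h
      · rw [hfA x hx, hfB y hy] at h
        have := hφA x hx; have := hψB y hy; omega
      · rw [hfB x hx, hfA y hy] at h
        have := hψB x hx; have := hφA y hy; omega
      · rw [hfB x hx, hfB y hy] at h
        have := hψB x hx; have := hψB y hy
        exact hψ hx hy (by omega))
  let e : {x // x ∈ range n} ≃ Fin n :=
    ⟨fun x => ⟨x, mem_range.1 x.2⟩, fun i => ⟨i, mem_range.2 i.2⟩, fun _ => rfl, fun _ => rfl⟩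
  refine ⟨g.trans e, fun x hx => ?_, fun x hx => ?_⟩
  · change ((g x : ℕ)) < _
    rw [hg x (mem_union_left _ hx), hfA x hx]; exact hφA x hx
  · change _ ≤ ((g x : ℕ)) + _
    rw [hg x (mem_union_right _ hx), hfB x hx]; have := hψB x hx; omega

theorem AGL_apply {q : ℕ} [NeZero q] {u : (ZMod q)ˣ} {f : Equiv.Perm (Fin q)} (hf : f ∈ AGL q u) :
    ∃ (a : (ZMod q)ˣ) (b : ZMod q), ∀ x, f (residue q x) = residue q (a * x + b) := by
  induction hf using Subgroup.closure_induction with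
  | mem f hf =>
    rcases hf with rfl | rfl
    · exact ⟨1, 1, fun x => by simp [Equiv.permCongr_apply]⟩
    · exact ⟨u, 0, fun x => by simp [Equiv.permCongr_apply]⟩
  | one => exact ⟨1, 0, fun x => by simp⟩
  | mul f g _ _ hf hg =>
    obtain ⟨a, b, hf⟩ := hf
    obtain ⟨c, d, hg⟩ := hg
    refine ⟨a * c, a * d + b, fun x => ?_⟩
    rw [Equiv.Perm.mul_apply, hg, hf]
    congr 1
    push_cast; ring
  | inv f _ hf =>
    obtain ⟨a, b, hf⟩ := hf
    refine ⟨a⁻¹, -(↑a⁻¹ * b), fun x => ?_⟩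
    rw [Equiv.Perm.inv_eq_iff_eq, hf]
    congr 1
    rw [mul_add, mul_neg, Units.mul_inv_cancel_left, Units.mul_inv_cancel_left]
    ring

theorem addRight_mem_AGL {q : ℕ} [NeZero q] (u : (ZMod q)ˣ) (b : ZMod q) :
    (residue q).permCongr (Equiv.addRight b) ∈ AGL q u := by
  have h : ∀ n : ℕ, (residue q).permCongr (Equiv.addRight (n : ZMod q)) ∈ AGL q u := by
    intro n
    induction n with
    | zero =>
      convert (AGL q u).one_mem
      ext x; simp [Equiv.permCongr_apply]
    | succ n ih =>
      have h1 : (residue q).permCongr (Equiv.addRight (1 : ZMod q)) ∈ AGL q u :=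
        Subgroup.subset_closure (Or.inl rfl)
      convert (AGL q u).mul_mem h1 ih using 1
      ext x; simp [Equiv.permCongr_apply, add_assoc]
  simpa using h b.val

/-! ### Minimal distance and far pairs -/

theorem minDist_le_dist {n : ℕ} {C : Set (Equiv.Perm (Fin n))} {f g : Equiv.Perm (Fin n)}
    (hf : f ∈ C) (hg : g ∈ C) (hfg : f ≠ g) : minDist C ≤ dist f g :=
  Nat.sInf_le ⟨f, hf, g, hg, hfg, rfl⟩

theorem le_minDist {n D : ℕ} {C : Set (Equiv.Perm (Fin n))} (hC : C.Nontrivial)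
    (h : ∀ f ∈ C, ∀ g ∈ C, f ≠ g → D ≤ dist f g) : D ≤ minDist C := by
  obtain ⟨f, hf, g, hg, hfg⟩ := hC
  refine le_csInf ⟨_, f, hf, g, hg, hfg, rfl⟩ ?_
  rintro _ ⟨f, hf, g, hg, hfg, rfl⟩
  exact h f hf g hg hfg

/-- In `{0, …, q-1}` there are at most `r * (r + 1)` ordered pairs of distinct elements at distance
at least `q - r`. -/
theorem exists_injOn_far_pairs (q D : ℕ) :
    ∃ φ : ℕ × ℕ → ℕ × ℕ,
      Set.InjOn φ {p | p.1 < q ∧ p.2 < q ∧ p.1 ≠ p.2 ∧ D ≤ ((p.1 : ℤ) - p.2).natAbs} ∧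
      ∀ p ∈ {p : ℕ × ℕ | p.1 < q ∧ p.2 < q ∧ p.1 ≠ p.2 ∧ D ≤ ((p.1 : ℤ) - p.2).natAbs},
        (φ p).1 < q - D ∧ (φ p).2 < q - D + 1 := by
  -- With r = q - D, increasing pairs go to the triangle first ≥ second of an r × (r+1) rectangle,
  -- decreasing pairs to the triangle first < second.
  refine ⟨fun p => if p.1 < p.2 then (p.1 + (q - 1 - p.2), p.1)
    else (p.2, q - 1 - p.1 + p.2 + 1), ?_, ?_⟩
  · rintro ⟨i, j⟩ ⟨h1, h2, h3, h4⟩ ⟨i', j'⟩ ⟨h1', h2', h3', h4'⟩ h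
    simp only at *
    split_ifs at h <;> simp only [Prod.mk.injEq] at h ⊢ <;> omega
  · rintro ⟨i, j⟩ ⟨h1, h2, h3, h4⟩
    simp only at *
    split_ifs <;> simp only <;> omega

/-- Translations alone force the minimal distance of any relabeling of `AGL(q)` to be small. -/
theorem le_mul_succ_of_minDist_relabel {q : ℕ} [NeZero q] (u : (ZMod q)ˣ)
    (l : Equiv.Perm (Fin q)) :
    q - 1 ≤ (q - minDist (relabel l (AGL q u))) * (q - minDist (relabel l (AGL q u)) + 1) := by
  set D := minDist (relabel l (AGL q u)) with hD
  have key : ∀ b : ZMod q, b ≠ 0 → ∃ x : ZMod q,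
      D ≤ (((l (residue q (x + b)) : ℕ) : ℤ) - (l (residue q x) : ℕ)).natAbs := by
    intro b hb
    set t := (residue q).permCongr (Equiv.addRight b) with ht
    have hne : l * t * l⁻¹ ≠ 1 := by
      intro h
      rw [mul_inv_eq_one, mul_eq_left] at h
      have := congrArg (fun f => f (residue q 0)) h
      simp [ht, Equiv.permCongr_apply] at this
      exact hb this
    have h1 : D ≤ dist (l * t * l⁻¹) 1 := minDist_le_dist
      ⟨t, addRight_mem_AGL u b, rfl⟩ ⟨1, (AGL q u).one_mem, by simp⟩ hne
    obtain ⟨i, -, hi⟩ := exists_mem_eq_sup (univ : Finset (Fin q)) ⟨0, mem_univ _⟩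
      (fun i => (((l * t * l⁻¹) i : ℤ) - ((1 : Equiv.Perm (Fin q)) i : ℤ)).natAbs)
    refine ⟨(residue q).symm (l⁻¹ i), ?_⟩
    rw [dist, hi] at h1
    simpa [ht, Equiv.permCongr_apply] using h1
  choose! x hx using key
  obtain ⟨φ, hφ, hφr⟩ := exists_injOn_far_pairs q D
  let p : ZMod q → ℕ × ℕ := fun b => (l (residue q (x b + b)), l (residue q (x b)))
  have hp : ∀ b ∈ univ.erase (0 : ZMod q), p b ∈ {p : ℕ × ℕ | p.1 < q ∧ p.2 < q ∧ p.1 ≠ p.2 ∧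
      D ≤ ((p.1 : ℤ) - p.2).natAbs} := by
    intro b hb
    refine ⟨Fin.is_lt _, Fin.is_lt _, fun h => ?_, hx b (ne_of_mem_erase hb)⟩
    have := (residue q).injective (l.injective (Fin.val_injective h))
    exact ne_of_mem_erase hb (by simpa using this)
  have hle := card_le_card_of_injOn (s := univ.erase (0 : ZMod q))
    (t := range (q - D) ×ˢ range (q - D + 1)) (fun b => φ (p b))
    (fun b hb => by
      have := hφr _ (hp b hb)
      simpa using this)
    (fun b hb c hc h => by
      have h' := hφ (hp b hb) (hp c hc) h
      simp only [p, Prod.mk.injEq] at h'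
      have e1 := (residue q).injective (l.injective (Fin.val_injective h'.1))
      have e2 := (residue q).injective (l.injective (Fin.val_injective h'.2))
      rw [e2] at e1
      exact add_left_cancel e1)
  rwa [card_erase_of_mem (mem_univ _), card_univ, ZMod.card, card_product, card_range,
    card_range] at hle

/-! ### The two bounds -/

theorem relabel_nontrivial {n : ℕ} {C : Set (Equiv.Perm (Fin n))} (hC : C.Nontrivial)
    (l : Equiv.Perm (Fin n)) : (relabel l C).Nontrivial :=
  hC.image fun f g h => by simpa using h

theorem AGL_nontrivial {q : ℕ} [NeZero q] (hq : 1 < q) (u : (ZMod q)ˣ) :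
    (AGL q u : Set (Equiv.Perm (Fin q))).Nontrivial := by
  have : Fact (1 < q) := ⟨hq⟩
  refine ⟨_, addRight_mem_AGL u 1, 1, (AGL q u).one_mem, fun h => ?_⟩
  have := congrArg (fun f => f (residue q 0)) h
  simp [Equiv.permCongr_apply] at this

/-- A labeling whose bottom is mapped into its top by every nonidentity affine map gives a
relabeling with large minimal distance. -/
theorem le_Lmax_AGL {q : ℕ} [NeZero q] (hq : 1 < q) (u : (ZMod q)ˣ) {t : ℕ} (l : ZMod q ≃ Fin q)
    (h : ∀ (a : (ZMod q)ˣ) (b : ZMod q), ¬((a : ZMod q) = 1 ∧ b = 0) →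
      ∃ x, (l x : ℕ) < t ∧ q ≤ (l (a * x + b) : ℕ) + t) :
    q - 2 * t ≤ Lmax (AGL q u : Set (Equiv.Perm (Fin q))) := by
  let m : Equiv.Perm (Fin q) := (residue q).symm.trans l
  refine le_trans ?_ (le_sup (f := fun m => minDist (relabel m (AGL q u : Set _))) (mem_univ m))
  refine le_minDist (relabel_nontrivial (AGL_nontrivial hq u) m) ?_
  rintro _ ⟨c, hc, rfl⟩ _ ⟨d, hd, rfl⟩ hne
  obtain ⟨a, b, hab⟩ := AGL_apply ((AGL q u).mul_mem hc ((AGL q u).inv_mem hd))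
  obtain ⟨x, hx1, hx2⟩ := h a b (by
    rintro ⟨ha, hb⟩
    apply hne
    have : c * d⁻¹ = 1 := by
      ext i
      have := hab ((residue q).symm i)
      rw [ha, hb] at this
      simpa using congrArg Fin.val this
    rw [mul_inv_eq_one.1 this])
  -- At this point the two codewords take the labels of a x + b and x, where x ↦ a x + b is `c *
  -- d⁻¹`.
  refine le_trans ?_ (le_sup (f := fun i : Fin q => (((m * c * m⁻¹) i : ℤ) -
    ((m * d * m⁻¹) i : ℤ)).natAbs) (mem_univ (m (d⁻¹ (residue q x)))))
  have e1 : (m * c * m⁻¹) (m (d⁻¹ (residue q x))) = l (a * x + b) := by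
    have := hab x
    rw [Equiv.Perm.mul_apply] at this
    change m (c (m.symm (m _))) = _
    rw [Equiv.symm_apply_apply, this]
    simp [m]
  have e2 : (m * d * m⁻¹) (m (d⁻¹ (residue q x))) = l x := by
    simp [m]
  simp only [e1, e2]
  omega

theorem Lmax_AGL_le {q : ℕ} [Fact q.Prime] (u : (ZMod q)ˣ) :
    (Lmax (AGL q u : Set (Equiv.Perm (Fin q))) : ℤ) ≤
      (q : ℤ) - ⌈(Real.sqrt (4 * (q : ℝ) - 3) - 1) / 2⌉ := by
  obtain ⟨l, -, hl⟩ := Finset.exists_mem_eq_sup (Finset.univ : Finset (Equiv.Perm (Fin q)))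
    ⟨1, Finset.mem_univ _⟩ (fun l => minDist (relabel l (AGL q u : Set _)))
  rw [Lmax, hl]
  have h := le_mul_succ_of_minDist_relabel u l
  have hq : 2 ≤ q := (Fact.out : q.Prime).two_le
  generalize minDist (relabel l (AGL q u : Set _)) = D at h ⊢
  have hDq : D ≤ q := by
    by_contra! h'
    rw [Nat.sub_eq_zero_of_le h'.le] at h
    omega
  rw [le_sub_comm, Int.ceil_le]
  obtain ⟨r, rfl⟩ := Nat.exists_eq_add_of_le hDq
  rw [Nat.add_sub_cancel_left, Nat.sub_le_iff_le_add] at h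
  have h' : ((D + r : ℕ) : ℝ) ≤ r * (r + 1) + 1 := by exact_mod_cast h
  -- q - 1 ≤ r(r+1) amounts to 4q - 3 ≤ (2r+1)².
  have hsq : Real.sqrt (4 * ((D + r : ℕ) : ℝ) - 3) ≤ 2 * r + 1 :=
    Real.sqrt_le_iff.2 ⟨by positivity, by nlinarith⟩
  push_cast at hsq ⊢
  linarith

theorem le_Lmax_AGL_sqrt {q : ℕ} [Fact q.Prime] (hq : 3 ≤ q) (u : (ZMod q)ˣ) :
    (q : ℝ) - 50 * Real.sqrt ((q : ℝ) * Real.log (q : ℝ)) ≤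
      (Lmax (AGL q u : Set (Equiv.Perm (Fin q))) : ℝ) := by
  set R := Real.sqrt ((q : ℝ) * Real.log (q : ℝ)) with hR
  have hq3 : (3 : ℝ) ≤ q := by exact_mod_cast hq
  have hlog : 1 ≤ Real.log q := by
    rw [Real.le_log_iff_exp_le (by linarith)]
    exact Real.exp_one_lt_d9.le.trans (by linarith)
  have hRsq : R ^ 2 = q * Real.log q := Real.sq_sqrt (by nlinarith)
  have hR1 : 1 ≤ R := Real.one_le_sqrt.2 (by nlinarith)
  rcases le_or_gt (q : ℝ) (50 * R) with hsmall | hbig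
  · exact (sub_nonpos.2 hsmall).trans (Nat.cast_nonneg _)
  -- k j > (R/4)(8R) = 2 q ln q, as the hitting set requires. The final loss is at most 18R + 28 ≤
  -- 46R, using R ≥ 1.
  set k := ⌈R / 4⌉₊ with hk
  set j := ⌊8 * R⌋₊ + 1 with hj
  have hk1 : R / 4 ≤ k := Nat.le_ceil _
  have hk2 : (k : ℝ) < R / 4 + 1 := Nat.ceil_lt_add_one (by linarith)
  have hj1 : 8 * R < j := by rw [hj]; push_cast; exact Nat.lt_floor_add_one _
  have hj2 : (j : ℝ) ≤ 8 * R + 1 := by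
    rw [hj]; push_cast
    linarith [Nat.floor_le (show (0 : ℝ) ≤ 8 * R by linarith)]
  obtain ⟨A, B, hAB, hA, hB, hmeet⟩ := exists_disjoint_sets_affine_meet (q := q) (s := 4 * k + 5)
    (k := k) (j := j) (by omega) (by
      have : (3 * (4 * k + 5) : ℝ) ≤ q := by linarith
      exact_mod_cast this) le_rfl (by nlinarith)
  obtain ⟨l, hlA, hlB⟩ := exists_equiv_fin_bottom_top (ZMod.card q) hAB
  have hmain := le_Lmax_AGL (t := 4 * k + j + 9) (by omega) u l (fun a b hid => by
    obtain ⟨x, hxA, hxB⟩ := hmeet a b a.ne_zero hid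
    have h1 := hlA x hxA
    have h2 := hlB _ hxB
    exact ⟨x, by omega, by omega⟩)
  have hcast : (q : ℝ) ≤ Lmax (AGL q u : Set (Equiv.Perm (Fin q))) + 2 * (4 * k + j + 9) := by
    exact_mod_cast Nat.sub_le_iff_le_add.1 hmain
  linarith

end Relabeling

theorem mainTheorem7 :
    ∃ K : ℝ, 0 < K ∧ ∃ N : ℕ, ∀ (q : ℕ) [Fact q.Prime], N ≤ q →
      ∀ a : (ZMod q)ˣ, (∀ x : (ZMod q)ˣ, x ∈ Subgroup.zpowers a) →
        (q : ℝ) - K * Real.sqrt ((q : ℝ) * Real.log (q : ℝ)) ≤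
            (Relabeling.Lmax (Relabeling.AGL q a : Set (Equiv.Perm (Fin q))) : ℝ) ∧
          (Relabeling.Lmax (Relabeling.AGL q a : Set (Equiv.Perm (Fin q))) : ℤ) ≤
            (q : ℤ) - ⌈(Real.sqrt (4 * (q : ℝ) - 3) - 1) / 2⌉ := by
  exact ⟨50, by norm_num, 3, fun q _ hq a _ =>
    ⟨Relabeling.le_Lmax_AGL_sqrt hq a, Relabeling.Lmax_AGL_le a⟩⟩
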